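/- Let $d \ge 1$. For a compact set $C \subset \mathbb{R}^d$, the bounded gaps of $C$ are the bounded path-connected components of $\mathbb{R}^d \setminus C$, and $E$ denotes the union of the unbounded path-connected components of $\mathbb{R}^d \setminus C$ (a single component if $d \ge 2$, two intervals if $d = 1$ and $C\neq\emptyset$). If $C$ has bounded gaps, arrange them in a finite or infinite sequence $G_1, G_2, \dots$ of non-increasing diameter and define the thickness of $C$ by $$\tau(C) = \inf_n \frac{\operatorname{dist}\bigl(G_n,\ \bigcup_{1 \le i \le n-1} G_i \cup E\bigr)}{\operatorname{diam}(G_n)};$$ the value does not depend on the choice of the arrangement (if no such arrangement exists, set $\tau(C) = 0$). If $C$ has no bounded gaps, put $\tau(C) = +\infty$ if $C$ has non-empty interior and $\tau(C) = 0$ otherwise. In products, $0 \cdot (+\infty) = 0$. For a finite graph $G$ with adjacency relation $\sim$ and $m$ edges, and a set $B \subset \mathbb{R}^{n}$, the $G$ distance set of $B$ is $$\Delta_G(B) = \bigl\{ (|x^i - x^j|)_{i \sim j} \ :\ x^i \in B \text{ for every vertex } i,\ x^i \ne x^j \text{ for } i \neq j \bigr\} \subset \mathbb{R}^m,$$ where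 $|\cdot|$ is the Euclidean norm and the coordinates are indexed by the edges of $G$. Let $C_1, C_2 \subset \mathbb{R}^d$ be compact sets with $\tau(C_1)\,\tau(C_2) > 1$. Then for every finite tree $T$, the set $\Delta_T(C_1 \times C_2)$, with $C_1 \times C_2 \subset \mathbb{R}^{2d}$, has non-empty interior. -/

import Mathlib

open scoped ENNReal

noncomputable section

/-- The bounded gaps of `C`: the bounded path-connected components of the complement of `C`. -/
def boundedGaps {X : Type*} [MetricSpace X] (C : Set X) : Set (Set X) :=
  {G | ∃ x ∈ Cᶜ, G = pathComponentIn Cᶜ x ∧ Bornology.IsBounded G}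

/-- The unbounded gap `E` of `C`: the union of the unbounded path-connected components of the
complement of `C` (for compact `C` in `ℝ^d` there is one such component if `d ≥ 2`,
and `E` consists of two unbounded intervals if `d = 1` and `C` is non-empty). -/
def unboundedGap {X : Type*} [MetricSpace X] (C : Set X) : Set X :=
  {x | x ∈ Cᶜ ∧ ¬ Bornology.IsBounded (pathComponentIn Cᶜ x)}

/-- The distance `inf {|x - y| : x ∈ A, y ∈ B}` between two sets. -/
def setDist {X : Type*} [MetricSpace X] (A B : Set X) : ℝ≥0∞ :=
  ⨅ x ∈ A, ⨅ y ∈ B, edist x y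

/-- An arrangement of the bounded gaps of `C` in a finite or infinite sequence of non-increasing
diameter; `r G` is the position of the gap `G` in the sequence. -/
def IsGapOrdering {X : Type*} [MetricSpace X] (C : Set X) (r : boundedGaps C → ℕ) : Prop :=
  Function.Injective r ∧
    ∀ G H : boundedGaps C, r G < r H → Metric.ediam (H : Set X) ≤ Metric.ediam (G : Set X)

/-- `inf_n dist (G_n, ⋃_{i < n} G_i ∪ E) / diam G_n`, for the gaps in the order given by `r`. -/
def thicknessAlong {X : Type*} [MetricSpace X] (C : Set X) (r : boundedGaps C → ℕ) : ℝ≥0∞ :=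
  ⨅ G : boundedGaps C,
    setDist (G : Set X)
        ((⋃ H : boundedGaps C, ⋃ _ : r H < r G, (H : Set X)) ∪ unboundedGap C) /
      Metric.ediam (G : Set X)

open Classical in
/-- The thickness `τ(C)`. If `C` has bounded gaps, it is computed along an ordering of the gaps by
non-increasing diameter; by `thickness_eq_thicknessAlong` below, the choice of the ordering is
immaterial, so that the supremum only serves to pick the common value (it is `0` if the gaps of `C`
cannot be so ordered). -/
def thickness {X : Type*} [MetricSpace X] (C : Set X) : ℝ≥0∞ :=
  if (boundedGaps C).Nonempty then
    ⨆ r : {r : boundedGaps C → ℕ // IsGapOrdering C r}, thicknessAlong C r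
  else if (interior C).Nonempty then ∞ else 0

theorem thicknessAlong_le {X : Type*} [NormedAddCommGroup X] [NormedSpace ℝ X] [Nontrivial X]
    {C : Set X} (hC : IsClosed C) {r s : boundedGaps C → ℕ}
    (hr : IsGapOrdering C r) (hs : IsGapOrdering C s) :
    thicknessAlong C r ≤ thicknessAlong C s := by
  have hfin : ∀ G : boundedGaps C, Metric.ediam (G : Set X) ≠ ∞ := by
    rintro ⟨G, x, hx, rfl, hb⟩
    exact hb.ediam_ne_top
  have hpos : ∀ G : boundedGaps C, Metric.ediam (G : Set X) ≠ 0 := by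
    rintro ⟨G, x, hx, rfl, hb⟩ h0
    have hsub : (pathComponentIn Cᶜ x).Subsingleton := Metric.ediam_eq_zero_iff.mp h0
    have hopen : IsOpen (pathComponentIn Cᶜ x) := hC.isOpen_compl.pathComponentIn x
    have hmem : x ∈ pathComponentIn Cᶜ x := mem_pathComponentIn_self hx
    have hsing : pathComponentIn Cᶜ x = {x} := hsub.eq_singleton_of_mem hmem
    have := Module.punctured_nhds_neBot ℝ X x
    exact not_isOpen_singleton x (hsing ▸ hopen)
  have key : ∀ (G : boundedGaps C) (x : X), x ∈ (G : Set X) → ∀ y : X,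
      (y ∈ unboundedGap C ∨ ∃ H : boundedGaps C, r H < r G ∧ y ∈ (H : Set X)) →
      thicknessAlong C r * Metric.ediam (G : Set X) ≤ edist x y := by
    intro G x hx y hy
    have h1 := (ENNReal.le_div_iff_mul_le (Or.inl (hpos G)) (Or.inl (hfin G))).mp
      (iInf_le _ G : thicknessAlong C r ≤ _)
    refine h1.trans ((iInf₂_le x hx).trans (iInf₂_le y ?_))
    rcases hy with hy | ⟨H, hH, hy⟩
    · exact Or.inr hy
    · exact Or.inl (Set.mem_iUnion₂.mpr ⟨H, hH, hy⟩)
  refine le_iInf fun G => ?_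
  rw [ENNReal.le_div_iff_mul_le (Or.inl (hpos G)) (Or.inl (hfin G))]
  refine le_iInf₂ fun x hx => le_iInf₂ fun y hy => ?_
  rcases hy with hy | hy
  · obtain ⟨H, hH, hy⟩ := Set.mem_iUnion₂.mp hy
    have hGH := hs.2 H G hH
    rcases lt_trichotomy (r H) (r G) with h | h | h
    · exact key G x hx y (Or.inr ⟨H, h, hy⟩)
    · exact absurd (hr.1 h ▸ hH) (lt_irrefl _)
    · rw [edist_comm]
      exact (mul_le_mul_right hGH _).trans (key H y hy x (Or.inr ⟨G, h, hx⟩))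
  · exact key G x hx y (Or.inl hy)

/-- The thickness may be computed along any ordering of the gaps by non-increasing diameter. -/
theorem thickness_eq_thicknessAlong {X : Type*} [NormedAddCommGroup X] [NormedSpace ℝ X]
    [Nontrivial X] {C : Set X} (hC : IsClosed C) (hne : (boundedGaps C).Nonempty)
    {r : boundedGaps C → ℕ} (hr : IsGapOrdering C r) :
    thickness C = thicknessAlong C r := by
  rw [thickness, if_pos hne]
  exact le_antisymm (iSup_le fun s => thicknessAlong_le hC s.2 hr)
    (le_iSup (fun s : {r : boundedGaps C → ℕ // IsGapOrdering C r} => thicknessAlong C s) ⟨r, hr⟩)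

/-- `C₁ × C₂` as a subset of `ℝ^d × ℝ^d = ℝ^{2d}` with the Euclidean distance. -/
def euclideanProd {d : ℕ} (C₁ C₂ : Set (EuclideanSpace ℝ (Fin d))) :
    Set (WithLp 2 (EuclideanSpace ℝ (Fin d) × EuclideanSpace ℝ (Fin d))) :=
  {z | z.fst ∈ C₁ ∧ z.snd ∈ C₂}

/-- The `G` distance set of `B`: the vectors of edge lengths `(|x^i - x^j|)_{i ∼ j}`, indexed by
the edges of `G`, for pairwise distinct points `x^i` of `B` indexed by the vertices of `G`. -/
def graphDistanceSet {V X : Type*} [MetricSpace X] (G : SimpleGraph V) (B : Set X) :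
    Set (G.edgeSet → ℝ) :=
  {a | ∃ x : V → X, (∀ i, x i ∈ B) ∧ Function.Injective x ∧
    ∀ (i j : V) (h : G.Adj i j), a ⟨s(i, j), G.mem_edgeSet.mpr h⟩ = dist (x i) (x j)}

end

/-!
A realisation of a tree is built leaf by leaf: a new leaf is attached to a point `x` as soon as the
distances from `x` to the set fill an interval of small lengths, and this interval must not change
when `x` moves slightly. Since lengths as small as desired are available, a new leaf may be chosen
closer to its neighbour than any two earlier vertices are to each other, which keeps the vertices
distinct.

If `d ≥ 2`, one copy `C₁ × {q}` of `C₁` suffices. Either `C₁` contains a ball, or it contains the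
frontier of a component `W` of the complement of the closure of a bounded gap `G`. A small sphere
around a point of this frontier is connected and meets both `W` and `G`, hence also the frontier.

If `d = 1`, the equation `(a - x₁) ^ 2 + (b - x₂) ^ 2 = t ^ 2` says that `(a - x₁) ^ 2`, for `a` in
`C₁`, equals `t ^ 2 - (b - x₂) ^ 2`, for `b` in `C₂`. On small pieces of `C₁` and `C₂` both
functions are nearly affine and hence nearly preserve thickness, and Newhouse's gap lemma makes the
two images intersect.
-/

open Filter Topology Set Metric
open scoped Pointwise

section Trees

variable {V X S : Type*} [MetricSpace X]

/-- The points `x i` realise the graph `G` with edge lengths `t` and pairwise distances at least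
`δ`. Edge lengths are functions on `Sym2 V`, whose values at non-edges are irrelevant. -/
structure IsRealization (G : SimpleGraph V) (δ : ℝ) (t : Sym2 V → ℝ) (x : V → X) : Prop where
  le_dist : Pairwise fun i j => δ ≤ dist (x i) (x j)
  dist_eq : ∀ i j, G.Adj i j → dist (x i) (x j) = t s(i, j)

/-- For suitable states of its vertices, the graph `G` has uniformly separated realisations close
to these states with all systems of edge lengths close to some `t₀`. The filter `N s` describes
closeness to the state `s`; the separation `δ` must not depend on how close the realisations are to
the states. -/
def StablyRealizable (N : S → Filter X) (G : SimpleGraph V) : Prop :=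
  ∃ (s : V → S) (t₀ : Sym2 V → ℝ), ∃ δ > 0, ∀ A : V → Set X, (∀ i, A i ∈ N (s i)) →
    ∀ᶠ t in 𝓝 t₀, ∃ x : V → X, (∀ i, x i ∈ A i) ∧ IsRealization G δ t x

/-- Points close to a state see points close to some successor state at all distances close to a
prescribed one, which can be chosen arbitrarily small. -/
def PropagatesDistances (N : S → Filter X) : Prop :=
  ∀ s, ∀ δ > 0, ∃ s', ∃ t₀ ∈ Ioo 0 δ, ∀ A ∈ N s',
    ∀ᶠ p : X × ℝ in N s ×ˢ 𝓝 t₀, ∃ y ∈ A, dist p.1 y = p.2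

lemma IsRealization.injective {G : SimpleGraph V} {δ : ℝ} {t : Sym2 V → ℝ} {x : V → X}
    (h : IsRealization G δ t x) (hδ : 0 < δ) : Function.Injective x := fun i j hij => by
  by_contra hne
  exact (h.le_dist hne).not_gt (by simpa [hij] using hδ)

lemma eq_or_exists_coe_compl_singleton_eq (v i : V) : v = i ∨ ∃ j : ({v}ᶜ : Set V), (j : V) = i :=
  (eq_or_ne v i).imp_right fun h => ⟨⟨i, h.symm⟩, rfl⟩

lemma not_exists_coe_compl_singleton_eq (v : V) : ¬ ∃ j : ({v}ᶜ : Set V), (j : V) = v :=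
  fun ⟨j, hj⟩ => j.2 hj

lemma IsRealization.extend_leaf {G : SimpleGraph V} {v u : V} (huv : u ∈ ({v}ᶜ : Set V))
    (hu : ∀ w, G.Adj v w → w = u) {δ ε : ℝ} {t : Sym2 V → ℝ} {x : ({v}ᶜ : Set V) → X} {y : X}
    (hx : IsRealization (G.induce {v}ᶜ) δ (t ∘ Sym2.map Subtype.val) x)
    (hxy : dist (x ⟨u, huv⟩) y = t s(v, u)) (hε : ε ≤ t s(v, u)) (hδ : t s(v, u) + ε ≤ δ) :
    IsRealization G ε t (Function.extend Subtype.val x fun _ => y) := by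
  have hx_apply (i : ({v}ᶜ : Set V)) : Function.extend Subtype.val x (fun _ => y) i = x i :=
    Subtype.val_injective.extend_apply ..
  have hy_apply : Function.extend Subtype.val x (fun _ => y) v = y :=
    Function.extend_apply' _ _ _ (not_exists_coe_compl_singleton_eq v)
  have hle (i) : ε ≤ dist (x i) y := by
    rcases eq_or_ne i ⟨u, huv⟩ with rfl | hi
    · exact hxy ▸ hε
    · linarith [hx.le_dist hi, dist_triangle_right (x i) (x ⟨u, huv⟩) y]
  have hεδ : ε ≤ δ := by linarith [hxy ▸ dist_nonneg (x := x ⟨u, huv⟩) (y := y)]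
  refine ⟨fun i j hij => ?_, fun i j hij => ?_⟩ <;>
    obtain rfl | ⟨i, rfl⟩ := eq_or_exists_coe_compl_singleton_eq v i <;>
    obtain rfl | ⟨j, rfl⟩ := eq_or_exists_coe_compl_singleton_eq v j <;>
    simp only [hx_apply, hy_apply]
  · exact absurd rfl hij
  · exact dist_comm y (x j) ▸ hle j
  · exact hle i
  · exact hεδ.trans (hx.le_dist fun h => hij (congrArg _ h))
  · exact absurd rfl hij.ne
  · obtain rfl := hu _ hij
    rw [dist_comm, hxy]
  · obtain rfl := hu _ hij.symm
    rw [hxy, Sym2.eq_swap]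
  · exact hx.dist_eq i j hij

variable {N : S → Filter X}

lemma StablyRealizable.of_subsingleton [Subsingleton V] [Nonempty S] [∀ s, (N s).NeBot]
    (G : SimpleGraph V) : StablyRealizable N G := by
  refine ⟨fun _ => Classical.arbitrary S, 0, 1, one_pos, fun A hA => .of_forall fun t => ?_⟩
  choose x hx using fun i => Filter.nonempty_of_mem (hA i)
  exact ⟨x, hx, fun i j h => absurd (Subsingleton.elim i j) h,
    fun i j h => absurd (Subsingleton.elim i j) h.ne⟩

lemma StablyRealizable.of_induce_compl_leaf (hN : PropagatesDistances N) {G : SimpleGraph V}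
    {v : V} (hv : ∃! u, G.Adj v u) (hG : StablyRealizable N (G.induce {v}ᶜ)) :
    StablyRealizable N G := by
  obtain ⟨u, hvu, hu_unique⟩ := hv
  obtain ⟨s, t₀, δ, hδ, hreal⟩ := hG
  let u' : ({v}ᶜ : Set V) := ⟨u, hvu.ne'⟩
  obtain ⟨s', τ, ⟨hτ, hτδ⟩, hstep⟩ := hN (s u') (δ / 2) (half_pos hδ)
  let r : Sym2 ({v}ᶜ : Set V) → Sym2 V := Sym2.map Subtype.val
  let t₁ : Sym2 V → ℝ := Function.extend r t₀ fun _ => τ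
  have ht₁_comp : t₁ ∘ r = t₀ := Function.extend_comp (Sym2.map.injective Subtype.val_injective) ..
  have ht₁_leaf : t₁ s(v, u) = τ := Function.extend_apply' _ _ _ fun ⟨e, he⟩ =>
    have ⟨i, _, hi⟩ := Sym2.mem_map.mp (he ▸ Sym2.mem_mk_left v u)
    i.2 hi
  refine ⟨Function.extend Subtype.val s fun _ => s', t₁, τ / 2, half_pos hτ, fun A hA => ?_⟩
  have hAv : A v ∈ N s' := by
    simpa only [Function.extend_apply' _ _ _ (not_exists_coe_compl_singleton_eq v)] using hA v
  obtain ⟨P, hP, Q, hQ, hPQ⟩ := eventually_prod_iff.mp (hstep _ hAv)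
  have hshrink (i : ({v}ᶜ : Set V)) : A i ∩ {x | i = u' → P x} ∈ N (s i) := by
    refine inter_mem (by simpa only [Subtype.val_injective.extend_apply] using hA i) ?_
    rcases eq_or_ne i u' with rfl | hi
    · filter_upwards [hP] with x hx _ using hx
    · simp [hi]
  have hcont : Continuous fun t : Sym2 V → ℝ => t ∘ r := by fun_prop
  filter_upwards [(ht₁_comp ▸ hcont.tendsto t₁).eventually (hreal _ hshrink),
    (ht₁_leaf ▸ (continuous_apply s(v, u)).tendsto t₁).eventually
      (hQ.and (Ioo_mem_nhds (half_lt_self hτ) hτδ))]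
    with t ⟨x, hxA, hx⟩ ⟨htQ, hτt, htδ⟩
  obtain ⟨y, hyA, hxy⟩ := hPQ ((hxA u').2 rfl) htQ
  refine ⟨_, fun i => ?_, hx.extend_leaf hvu.ne' hu_unique hxy hτt.le (by linarith)⟩
  obtain rfl | ⟨i, rfl⟩ := eq_or_exists_coe_compl_singleton_eq v i
  · rwa [Function.extend_apply' _ _ _ (not_exists_coe_compl_singleton_eq v)]
  · rw [Subtype.val_injective.extend_apply]
    exact (hxA i).1

lemma StablyRealizable.of_isTree [Nonempty S] [∀ s, (N s).NeBot] (hN : PropagatesDistances N)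
    [Finite V] {T : SimpleGraph V} (hT : T.IsTree) : StablyRealizable N T := by
  classical
  induction hn : Nat.card V generalizing V with
  | zero => exact absurd hn (have := hT.connected.nonempty; Nat.card_pos.ne')
  | succ n ih =>
    have := Fintype.ofFinite V
    rcases subsingleton_or_nontrivial V with _ | _
    · exact .of_subsingleton T
    obtain ⟨v, hv⟩ := hT.exists_vert_degree_one_of_nontrivial
    have hT' : (T.induce {v}ᶜ).IsTree :=
      ⟨hT.connected.induce_compl_singleton_of_degree_eq_one hv, hT.isAcyclic.induce _⟩
    refine .of_induce_compl_leaf hN (SimpleGraph.degree_eq_one_iff_existsUnique_adj.mp hv)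
      (ih hT' ?_)
    rw [Nat.card_coe_set_eq, Set.ncard_compl, Set.ncard_singleton, hn, Nat.add_sub_cancel]

theorem interior_graphDistanceSet_nonempty [Nonempty S] [∀ s, (N s).NeBot] {B : Set X}
    (hN : PropagatesDistances N) (hB : ∀ s, B ∈ N s) [Finite V] {T : SimpleGraph V}
    (hT : T.IsTree) : (interior (graphDistanceSet T B)).Nonempty := by
  obtain ⟨s, t₀, δ, hδ, hreal⟩ := StablyRealizable.of_isTree hN hT
  classical
  let extendByT₀ (a : T.edgeSet → ℝ) : Sym2 V → ℝ :=
    fun e => if he : e ∈ T.edgeSet then a ⟨e, he⟩ else t₀ e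
  have hcont : Continuous extendByT₀ := by
    refine continuous_pi fun e => ?_
    by_cases he : e ∈ T.edgeSet <;> simp only [extendByT₀, he, dite_true, dite_false] <;> fun_prop
  have ht₀ : extendByT₀ (t₀ ∘ Subtype.val) = t₀ := by
    ext e
    simp [extendByT₀]
  refine ⟨t₀ ∘ Subtype.val, mem_interior_iff_mem_nhds.mpr ?_⟩
  filter_upwards [(ht₀ ▸ hcont.tendsto _).eventually (hreal (fun _ => B) fun i => hB _)]
    with a ⟨x, hxB, hx⟩
  exact ⟨x, hxB, hx.injective hδ, fun i j h => by
    exact ((hx.dist_eq i j h).trans (dif_pos (T.mem_edgeSet.mpr h))).symm⟩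

lemma graphDistanceSet_subset_of_isometry {Y : Type*} [MetricSpace Y] {φ : X → Y}
    (hφ : Isometry φ) {B : Set X} {B' : Set Y} (h : MapsTo φ B B') (G : SimpleGraph V) :
    graphDistanceSet G B ⊆ graphDistanceSet G B' := by
  rintro a ⟨x, hxB, hx, ha⟩
  exact ⟨φ ∘ x, fun i => h (hxB i), hφ.injective.comp hx, fun i j hij => by
    rw [ha i j hij, Function.comp_apply, Function.comp_apply, hφ.dist_eq]⟩

end Trees

section Thickness

lemma thicknessAlong_mul_ediam_le_edist {X : Type*} [MetricSpace X] {C : Set X}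
    (r : boundedGaps C → ℕ) {G : boundedGaps C} {x y : X} (hx : x ∈ (G : Set X))
    (hy : y ∈ (⋃ H : boundedGaps C, ⋃ _ : r H < r G, (H : Set X)) ∪ unboundedGap C) :
    thicknessAlong C r * ediam (G : Set X) ≤ edist x y :=
  (ENNReal.mul_le_of_le_div (iInf_le _ G)).trans ((iInf₂_le x hx).trans (iInf₂_le y hy))

lemma thicknessAlong_mul_min_ediam_le_edist {X : Type*} [MetricSpace X] {C : Set X}
    {r : boundedGaps C → ℕ} (hr : Function.Injective r) {x y : X} (hx : x ∉ C) (hy : y ∉ C)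
    (hxy : ¬ JoinedIn Cᶜ x y) (hb : Bornology.IsBounded (pathComponentIn Cᶜ x)) :
    thicknessAlong C r * min (ediam (pathComponentIn Cᶜ x)) (ediam (pathComponentIn Cᶜ y)) ≤
      edist x y := by
  let G : boundedGaps C := ⟨_, x, hx, rfl, hb⟩
  have hxG : x ∈ (G : Set X) := mem_pathComponentIn_self hx
  have hyH : y ∈ pathComponentIn Cᶜ y := mem_pathComponentIn_self hy
  have of_mem (h : y ∈ (⋃ H : boundedGaps C, ⋃ _ : r H < r G, (H : Set X)) ∪ unboundedGap C) :
      thicknessAlong C r * min (ediam (G : Set X)) (ediam (pathComponentIn Cᶜ y)) ≤ edist x y :=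
    (mul_le_mul_right (min_le_left ..) _).trans (thicknessAlong_mul_ediam_le_edist r hxG h)
  by_cases hb' : Bornology.IsBounded (pathComponentIn Cᶜ y)
  swap
  · exact of_mem (.inr ⟨hy, hb'⟩)
  let H : boundedGaps C := ⟨_, y, hy, rfl, hb'⟩
  rcases lt_trichotomy (r H) (r G) with hlt | heq | hlt
  · exact of_mem (.inl (mem_iUnion₂.mpr ⟨H, hlt, hyH⟩))
  · exact absurd (congrArg Subtype.val (hr heq) ▸ hyH : y ∈ (G : Set X)) hxy
  · rw [edist_comm]
    exact (mul_le_mul_right (min_le_right ..) _).trans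
      (thicknessAlong_mul_ediam_le_edist r hyH (.inl (mem_iUnion₂.mpr ⟨G, hlt, hxG⟩)))

lemma thickness_mul_min_ediam_le_edist {X : Type*} [MetricSpace X] {C : Set X} {x y : X}
    (hx : x ∉ C) (hy : y ∉ C) (hxy : ¬ JoinedIn Cᶜ x y)
    (hb : Bornology.IsBounded (pathComponentIn Cᶜ x) ∨
      Bornology.IsBounded (pathComponentIn Cᶜ y)) :
    thickness C * min (ediam (pathComponentIn Cᶜ x)) (ediam (pathComponentIn Cᶜ y)) ≤
      edist x y := by
  wlog hbx : Bornology.IsBounded (pathComponentIn Cᶜ x) generalizing x y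
  · rw [min_comm, edist_comm]
    exact this hy hx (fun h => hxy h.symm) hb.symm (hb.resolve_left hbx)
  rw [thickness, if_pos ⟨_, x, hx, rfl, hbx⟩, ENNReal.iSup_mul]
  exact iSup_le fun r => thicknessAlong_mul_min_ediam_le_edist r.2.1 hx hy hxy hbx

lemma mem_unboundedGap_of_subset_singleton {E : Type*} [NormedAddCommGroup E] [NormedSpace ℝ E]
    {C : Set E} {p x : E} (hC : C ⊆ {p}) (hx : x ≠ p) : x ∈ unboundedGap C := by
  let ray : Set E := AffineMap.lineMap p x '' Ici (1 : ℝ)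
  have hx_ray : x ∈ ray := ⟨1, self_mem_Ici, AffineMap.lineMap_apply_one p x⟩
  have hray_compl : ray ⊆ Cᶜ := by
    rintro _ ⟨t, ht, rfl⟩ htC
    have ht0 := (AffineMap.lineMap_eq_left_iff.mp (hC htC)).resolve_left hx.symm
    exact zero_lt_one.not_ge (mem_Ici.mp (ht0 ▸ ht))
  have hray_connected : IsPathConnected ray :=
    ((convex_Ici 1).isPathConnected nonempty_Ici).image AffineMap.lineMap_continuous
  refine ⟨hray_compl hx_ray, fun hb => not_bddAbove_Ici (1 : ℝ) ?_⟩
  have := hb.subset (hray_connected.subset_pathComponentIn hx_ray hray_compl)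
  exact (((antilipschitzWith_lineMap hx.symm).isBounded_preimage this).subset
    (subset_preimage_image ..)).bddAbove

lemma nontrivial_of_thickness_ne_zero {E : Type*} [NormedAddCommGroup E] [NormedSpace ℝ E]
    [Nontrivial E] {C : Set E} (h : thickness C ≠ 0) : C.Nontrivial := by
  by_contra hC
  rw [not_nontrivial_iff] at hC
  have hgaps : ¬ (boundedGaps C).Nonempty := by
    rintro ⟨_, x, hx, rfl, hb⟩
    obtain ⟨p, hp, hxp⟩ : ∃ p, C ⊆ {p} ∧ x ≠ p := by
      rcases hC.eq_empty_or_singleton with rfl | ⟨p, rfl⟩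
      · exact (exists_ne x).imp fun p hp => ⟨empty_subset _, hp.symm⟩
      · exact ⟨p, subset_rfl, hx⟩
    exact (mem_unboundedGap_of_subset_singleton hp hxp).2 hb
  have hinterior : ¬ (interior C).Nonempty := by
    rcases hC.eq_empty_or_singleton with rfl | ⟨p, rfl⟩
    · simp
    · have := Module.punctured_nhds_neBot ℝ E p
      simp
  rw [thickness, if_neg hgaps, if_neg hinterior] at h
  exact h rfl

lemma exists_pos_ofReal_lt_of_one_lt_mul {x y : ℝ≥0∞} (h : 1 < x * y) :
    ∃ a b : ℝ, 0 < a ∧ 0 < b ∧ ENNReal.ofReal a < x ∧ ENNReal.ofReal b < y ∧ 1 < a * b := by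
  by_contra! hcon
  refine absurd h (not_lt.mpr (ENNReal.mul_le_of_forall_lt fun a ha b hb => ?_))
  lift a to NNReal using ha.ne_top
  lift b to NNReal using hb.ne_top
  rcases eq_or_ne a 0 with rfl | ha0
  · simp
  rcases eq_or_ne b 0 with rfl | hb0
  · simp
  have := hcon a b (by positivity) (by positivity) (by simpa using ha) (by simpa using hb)
  exact_mod_cast this

end Thickness

section SmallSpheres

variable {X : Type*} [MetricSpace X]

/-- The set `A` meets all sufficiently small spheres with centre in `K`, uniformly in the centre. -/
def MeetsSmallSpheres (A K : Set X) : Prop :=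
  ∀ᶠ r in 𝓝[>] 0, ∀ y ∈ K, (A ∩ sphere y r).Nonempty

lemma propagatesDistances_principal {K : Set X} (hK : MeetsSmallSpheres K K) :
    PropagatesDistances fun _ : Unit => 𝓟 K := by
  intro _ δ hδ
  obtain ⟨ρ, hρ, hmeets⟩ := mem_nhdsGT_iff_exists_Ioo_subset.mp hK
  rw [mem_Ioi] at hρ
  refine ⟨(), min δ ρ / 2, ⟨by positivity, (half_lt_self (by positivity)).trans_le
    (min_le_left δ ρ)⟩, fun A hKA => ?_⟩
  filter_upwards [prod_mem_prod (mem_principal_self K) (Ioo_mem_nhds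
    (show 0 < min δ ρ / 2 by positivity)
    ((half_lt_self (by positivity)).trans_le (min_le_right δ ρ)))] with ⟨x, t⟩ ⟨hx, ht⟩
  obtain ⟨y, hyK, hxy⟩ := hmeets ht x hx
  exact ⟨y, hKA hyK, mem_sphere'.mp hxy⟩

lemma nonempty_inter_sphere_of_isPreconnected {A : Set X} (hA : IsPreconnected A) {a y : X} {r : ℝ}
    (hy : y ∈ closure A) (hr : 0 < r) (ha : a ∈ A) (hay : r ≤ dist a y) :
    (A ∩ sphere y r).Nonempty := by
  obtain ⟨w, hwA, hyw⟩ := Metric.mem_closure_iff.mp hy r hr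
  obtain ⟨x, hxA, hxr⟩ := hA.intermediate_value hwA ha (f := (dist · y)) (by fun_prop)
    ⟨(dist_comm y w ▸ hyw).le, hay⟩
  exact ⟨x, hxA, hxr⟩

lemma meetsSmallSpheres_closure {A : Set X} (hA : IsPreconnected A) (hA' : A.Nontrivial) :
    MeetsSmallSpheres A (closure A) := by
  obtain ⟨g, hg, g', hg', hne⟩ := hA'
  filter_upwards [Ioo_mem_nhdsGT (half_pos (dist_pos.mpr hne))] with r ⟨hr0, hr⟩ y hy
  rcases le_or_gt r (dist g y) with h | h
  · exact nonempty_inter_sphere_of_isPreconnected hA hy hr0 hg h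
  · exact nonempty_inter_sphere_of_isPreconnected hA hy hr0 hg'
      (by linarith [dist_triangle_right g g' y])

lemma nonempty_inter_frontier_of_isPreconnected {Y : Type*} [TopologicalSpace Y] {s W : Set Y}
    (hs : IsPreconnected s) (hW : (s ∩ W).Nonempty) (hW' : (s ∩ Wᶜ).Nonempty) :
    (s ∩ frontier W).Nonempty := by
  by_contra h
  have hcover : s ⊆ interior W ∪ (closure W)ᶜ := fun x hx => by
    by_contra hx'
    rw [mem_union, not_or, notMem_compl_iff] at hx'
    exact h ⟨x, hx, hx'.2, hx'.1⟩
  obtain ⟨x, -, hx, hx'⟩ := hs _ _ isOpen_interior isClosed_closure.isOpen_compl hcover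
    (hW.imp fun x hx => ⟨hx.1, (hcover hx.1).resolve_right (not_not.mpr (subset_closure hx.2))⟩)
    (hW'.imp fun x hx => ⟨hx.1, (hcover hx.1).resolve_left fun h => hx.2 (interior_subset h)⟩)
  exact hx' (subset_closure (interior_subset hx))

lemma frontier_pathComponentIn_subset_compl {Y : Type*} [TopologicalSpace Y]
    [LocallyPathConnectedSpace Y] {O : Set Y} (hO : IsOpen O) (z : Y) :
    frontier (pathComponentIn O z) ⊆ Oᶜ := by
  intro y hy hyO
  obtain ⟨w, hwy, hwz⟩ := mem_closure_iff.mp (frontier_subset_closure hy) _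
    (hO.pathComponentIn y) (mem_pathComponentIn_self hyO)
  rw [(hO.pathComponentIn z).frontier_eq] at hy
  refine hy.2 ?_
  rw [← pathComponentIn_congr hwz, pathComponentIn_congr hwy]
  exact mem_pathComponentIn_self hyO

variable {E : Type*} [NormedAddCommGroup E] [NormedSpace ℝ E]

lemma nontrivial_of_isOpen [Nontrivial E] {A : Set E} (hA : IsOpen A) (hA' : A.Nonempty) :
    A.Nontrivial := by
  obtain ⟨a, ha⟩ := hA'
  have := Module.punctured_nhds_neBot ℝ E a
  exact (infinite_of_mem_nhds a (hA.mem_nhds ha)).nontrivial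

lemma meetsSmallSpheres_frontier (hE : 1 < Module.rank ℝ E) {W G : Set E}
    (hW : IsPreconnected W) (hW' : W.Nontrivial) (hG : IsPreconnected G) (hG' : G.Nontrivial)
    (hWG : Disjoint W G) (hfrontier : frontier W ⊆ closure G) :
    MeetsSmallSpheres (frontier W) (frontier W) := by
  filter_upwards [meetsSmallSpheres_closure hW hW', meetsSmallSpheres_closure hG hG']
    with r hWr hGr y hy
  rw [inter_comm]
  refine nonempty_inter_frontier_of_isPreconnected (isPreconnected_sphere hE y r)
    (inter_comm _ _ ▸ hWr y (frontier_subset_closure hy)) ?_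
  obtain ⟨x, hxG, hx⟩ := hGr y (hfrontier hy)
  exact ⟨x, hx, hWG.notMem_of_mem_right hxG⟩

lemma exists_subset_frontier_meetsSmallSpheres (hE : 1 < Module.rank ℝ E) {G : Set E}
    (hG : IsPreconnected G) (hG' : G.Nontrivial) (hb : Bornology.IsBounded G) :
    ∃ K ⊆ frontier G, K.Nonempty ∧ MeetsSmallSpheres K K := by
  have : Nontrivial E := rank_pos_iff_nontrivial.mp (zero_lt_one.trans hE)
  obtain ⟨z, hz⟩ : ∃ z, z ∈ (closure G)ᶜ := by
    by_contra! h
    exact NormedSpace.unbounded_univ ℝ E (hb.closure.subset fun z _ => not_not.mp (h z))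
  let W := pathComponentIn (closure G)ᶜ z
  have hopen : IsOpen (closure G)ᶜ := isClosed_closure.isOpen_compl
  have hzW : z ∈ W := mem_pathComponentIn_self hz
  have hWG : W ⊆ Gᶜ := pathComponentIn_subset.trans (compl_subset_compl.mpr subset_closure)
  have hfrontier : frontier W ⊆ closure G :=
    (frontier_pathComponentIn_subset_compl hopen z).trans (compl_compl _).subset
  refine ⟨frontier W, ?_, nonempty_frontier_iff.mpr ⟨⟨z, hzW⟩, fun h => ?_⟩,
    meetsSmallSpheres_frontier hE (isPathConnected_pathComponentIn hz).isConnected.isPreconnected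
      (nontrivial_of_isOpen (hopen.pathComponentIn z) ⟨z, hzW⟩) hG hG'
      (subset_compl_iff_disjoint_right.mp hWG) hfrontier⟩
  · rw [frontier_eq_closure_inter_closure (s := G)]
    exact subset_inter hfrontier (frontier_subset_closure.trans (closure_mono hWG))
  · exact hG'.nonempty.elim fun g hg => hWG (h ▸ mem_univ g) hg

lemma exists_subset_meetsSmallSpheres_of_thickness_ne_zero (hE : 1 < Module.rank ℝ E) {C : Set E}
    (hC : IsClosed C) (h : thickness C ≠ 0) : ∃ K ⊆ C, K.Nonempty ∧ MeetsSmallSpheres K K := by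
  have : Nontrivial E := rank_pos_iff_nontrivial.mp (zero_lt_one.trans hE)
  rw [thickness] at h
  split_ifs at h with hgaps hinterior
  · obtain ⟨_, x, hx, rfl, hb⟩ := hgaps
    obtain ⟨K, hK, h⟩ := exists_subset_frontier_meetsSmallSpheres hE
      (isPathConnected_pathComponentIn hx).isConnected.isPreconnected
      (nontrivial_of_isOpen (hC.isOpen_compl.pathComponentIn x) ⟨x, mem_pathComponentIn_self hx⟩) hb
    exact ⟨K, hK.trans ((frontier_pathComponentIn_subset_compl hC.isOpen_compl x).trans
      (compl_compl C).subset), h⟩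
  · obtain ⟨p, hp⟩ := hinterior
    obtain ⟨ρ, hρ, hball⟩ := Metric.mem_nhds_iff.mp (mem_interior_iff_mem_nhds.mp hp)
    refine ⟨ball p ρ, hball, nonempty_ball.mpr hρ, ?_⟩
    filter_upwards [meetsSmallSpheres_closure (convex_ball p ρ).isPreconnected
      (nontrivial_of_isOpen isOpen_ball (nonempty_ball.mpr hρ))] with r hr y hy
    exact hr y (subset_closure hy)
  · exact absurd rfl h

theorem interior_graphDistanceSet_euclideanProd_nonempty_of_two_le {d : ℕ} (hd : 2 ≤ d)
    {C₁ C₂ : Set (EuclideanSpace ℝ (Fin d))} (hC₁ : IsClosed C₁) (h₁ : thickness C₁ ≠ 0)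
    (h₂ : C₂.Nonempty) {V : Type*} [Finite V] {T : SimpleGraph V} (hT : T.IsTree) :
    (interior (graphDistanceSet T (euclideanProd C₁ C₂))).Nonempty := by
  have hrank : 1 < Module.rank ℝ (EuclideanSpace ℝ (Fin d)) := by
    rw [← Module.finrank_eq_rank, finrank_euclideanSpace_fin]
    exact_mod_cast hd
  obtain ⟨K, hKC, hK_nonempty, hK⟩ :=
    exists_subset_meetsSmallSpheres_of_thickness_ne_zero hrank hC₁ h₁
  obtain ⟨q, hq⟩ := h₂
  let φ (x : EuclideanSpace ℝ (Fin d)) : WithLp 2 (_ × EuclideanSpace ℝ (Fin d)) :=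
    WithLp.toLp 2 (x, q)
  have hφ : Isometry φ := Isometry.of_dist_eq fun x y => by
    simp [φ, WithLp.prod_dist_eq_of_L2, Real.sqrt_sq dist_nonneg]
  have hφK : MapsTo φ K (euclideanProd C₁ C₂) := fun x hx => ⟨hKC hx, hq⟩
  have := principal_neBot_iff.mpr hK_nonempty
  exact (interior_graphDistanceSet_nonempty (propagatesDistances_principal hK)
    (fun _ => mem_principal_self K) hT).mono
    (interior_mono (graphDistanceSet_subset_of_isometry hφ hφK T))

end SmallSpheres

section ThickSubsetsOfTheLine

/-- The pairs `(u, v)` of points of `K` such that `K` has no point strictly between `u` and `v`,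
that is, the gaps of `K` between two of its points. Degenerate pairs with `v ≤ u` are allowed, so
that the set is closed. -/
def gapEndpoints (K : Set ℝ) : Set (ℝ × ℝ) :=
  K ×ˢ K ∩ {g | Disjoint (Ioo g.1 g.2) K}

lemma disjoint_Ioo_iff {K : Set ℝ} {u v : ℝ} :
    Disjoint (Ioo u v) K ↔ ∀ x ∈ K, x ≤ u ∨ v ≤ x := by
  simp only [disjoint_right, mem_Ioo, not_and_or, not_lt]

lemma disjoint_Ioo_neg {K : Set ℝ} {u v : ℝ} :
    Disjoint (Ioo u v) (-K) ↔ Disjoint (Ioo (-v) (-u)) K := by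
  simp only [disjoint_Ioo_iff]
  rw [neg_surjective.forall]
  exact forall_congr' fun x => by rw [Set.neg_mem_neg, neg_le, le_neg, or_comm]

lemma isCompact_gapEndpoints {K : Set ℝ} (hK : IsCompact K) : IsCompact (gapEndpoints K) := by
  refine (hK.prod hK).inter_right ?_
  simp only [disjoint_Ioo_iff, ofPred_forall, ofPred_or]
  exact isClosed_biInter fun x _ => (isClosed_le continuous_const continuous_fst).union
    (isClosed_le continuous_snd continuous_const)

lemma mem_gapEndpoints_neg {K : Set ℝ} {g : ℝ × ℝ} :
    g ∈ gapEndpoints (-K) ↔ (-g.2, -g.1) ∈ gapEndpoints K := by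
  simp only [gapEndpoints, mem_inter_iff, mem_prod, Set.mem_neg, mem_ofPred_eq,
    disjoint_Ioo_neg, and_comm (a := -g.1 ∈ K)]

lemma exists_gapEndpoints_of_notMem {K : Set ℝ} (hK : IsClosed K) {a b w : ℝ} (ha : a ∈ K)
    (hb : b ∈ K) (hw : w ∈ Icc a b) (hwK : w ∉ K) :
    ∃ g ∈ gapEndpoints K, a ≤ g.1 ∧ g.1 < w ∧ w < g.2 ∧ g.2 ≤ b := by
  obtain ⟨u, ⟨huK, hu⟩, hu_max⟩ :=
    (isCompact_Icc.inter_left hK).exists_isGreatest ⟨a, ha, left_mem_Icc.mpr hw.1⟩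
  obtain ⟨v, ⟨hvK, hv⟩, hv_min⟩ :=
    (isCompact_Icc.inter_left hK).exists_isLeast ⟨b, hb, right_mem_Icc.mpr hw.2⟩
  refine ⟨(u, v), ⟨⟨huK, hvK⟩, disjoint_Ioo_iff.mpr fun x hx => ?_⟩, hu.1,
    hu.2.lt_of_ne (ne_of_mem_of_not_mem huK hwK), hv.1.lt_of_ne' (ne_of_mem_of_not_mem hvK hwK),
    hv.2⟩
  rcases le_total x w with h | h
  · refine .inl ?_
    by_contra! hux
    exact hux.not_ge (hu_max ⟨hx, hu.1.trans hux.le, h⟩)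
  · refine .inr ?_
    by_contra! hxv
    exact hxv.not_ge (hv_min ⟨hx, h, hxv.le.trans hv.2⟩)

/-- Newhouse's gap condition: a segment `[v, s]` with end points in `K` which is flanked on both
sides by intervals of length `ℓ` missing `K` has length at least `τ * ℓ`, unless it contains all
of `K`. The flanking intervals may be bounded or unbounded gaps of `K`, or parts of them. -/
def IsThick (τ : ℝ) (K : Set ℝ) : Prop :=
  ∀ v ∈ K, ∀ s ∈ K, v ≤ s → ∀ ℓ > 0, Disjoint (Ioo (v - ℓ) v) K → Disjoint (Ioo s (s + ℓ)) K →
    ¬ K ⊆ Icc v s → τ * ℓ ≤ s - v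

lemma IsThick.neg {τ : ℝ} {K : Set ℝ} (h : IsThick τ K) : IsThick τ (-K) := by
  intro v hv s hs hvs ℓ hℓ hdv hds hK
  have := h (-s) hs (-v) hv (neg_le_neg hvs) ℓ hℓ
    (by convert disjoint_Ioo_neg.mp hds using 2; ring)
    (by convert disjoint_Ioo_neg.mp hdv using 2; ring)
    (fun hsub => hK (by simpa using neg_subset_neg.mpr hsub))
  linarith

/-- A compact set satisfying `IsThick τ`, with smallest element `a` and largest element `b ≠ a`. -/
structure IsThickSpan (τ : ℝ) (K : Set ℝ) (a b : ℝ) : Prop where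
  isCompact : IsCompact K
  isLeast : IsLeast K a
  isGreatest : IsGreatest K b
  lt : a < b
  isThick : IsThick τ K

lemma IsThick.exists_isThickSpan {τ : ℝ} {K : Set ℝ} (h : IsThick τ K) (hK : IsCompact K)
    (hnt : K.Nontrivial) : ∃ a b, IsThickSpan τ K a b := by
  obtain ⟨a, ha⟩ := hK.exists_isLeast hnt.nonempty
  obtain ⟨b, hb⟩ := hK.exists_isGreatest hnt.nonempty
  obtain ⟨x, hx, y, hy, hxy⟩ := hnt.exists_lt
  exact ⟨a, b, hK, ha, hb, (ha.2 hx).trans_lt (hxy.trans_le (hb.2 hy)), h⟩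

namespace IsThickSpan

variable {τ a b w η : ℝ} {K : Set ℝ} {g : ℝ × ℝ}

lemma neg (hK : IsThickSpan τ K a b) : IsThickSpan τ (-K) (-b) (-a) :=
  ⟨hK.isCompact.neg,
    ⟨neg_mem_neg.mpr hK.isGreatest.1, fun _ hx => neg_le_of_neg_le (hK.isGreatest.2 hx)⟩,
    ⟨neg_mem_neg.mpr hK.isLeast.1, fun _ hx => le_neg_of_le_neg (hK.isLeast.2 hx)⟩,
    neg_lt_neg hK.lt, hK.isThick.neg⟩

lemma mul_gap_le_left (hK : IsThickSpan τ K a b) (hg : g ∈ gapEndpoints K) (hlt : g.1 < g.2) :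
    τ * (g.2 - g.1) ≤ g.1 - a := by
  refine hK.isThick a hK.isLeast.1 g.1 hg.1.1 (hK.isLeast.2 hg.1.1) _ (sub_pos.mpr hlt)
    (disjoint_Ioo_iff.mpr fun x hx => .inr (hK.isLeast.2 hx)) ?_
    fun hsub => hlt.not_ge (hsub hg.1.2).2
  rw [add_sub_cancel]
  exact hg.2

lemma mul_gap_le_right (hK : IsThickSpan τ K a b) (hg : g ∈ gapEndpoints K) (hlt : g.1 < g.2) :
    τ * (g.2 - g.1) ≤ b - g.2 := by
  have := hK.neg.mul_gap_le_left (g := (-g.2, -g.1)) (by simpa [mem_gapEndpoints_neg] using hg)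
    (by simpa using hlt)
  dsimp only at this
  linarith

lemma exists_mem_Ioo (hK : IsThickSpan τ K a b) (hτ : 0 < τ) (hη : 0 < η) :
    ∃ c ∈ K, c ∈ Ioo a (a + η) := by
  by_contra! hcon
  have := hK.isThick a hK.isLeast.1 a hK.isLeast.1 le_rfl η hη
    (disjoint_Ioo_iff.mpr fun x hx => .inr (hK.isLeast.2 hx)) (disjoint_right.mpr hcon)
    fun hsub => hK.lt.not_ge (hsub hK.isGreatest.1).2
  linarith [mul_pos hτ hη]

lemma exists_gap_of_disjoint_Ioo (hK : IsThickSpan τ K a b) {v ℓ : ℝ} (hv : v ∈ K) (hav : a < v)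
    (hℓ : 0 < ℓ) (hd : Disjoint (Ioo (v - ℓ) v) K) : ∃ u ≤ v - ℓ, (u, v) ∈ gapEndpoints K := by
  rw [disjoint_Ioo_iff] at hd
  have hal : a ≤ v - ℓ := (hd a hK.isLeast.1).resolve_right hav.not_ge
  obtain ⟨g, hg, -, hg₁, hg₂, hgv⟩ := exists_gapEndpoints_of_notMem hK.isCompact.isClosed
    hK.isLeast.1 hv (w := v - ℓ / 2) ⟨by linarith, by linarith⟩ fun hmem => by grind
  have hg₁' := hd g.1 hg.1.1
  have hg₂' := hd g.2 hg.1.2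
  obtain rfl : g.2 = v := by grind
  exact ⟨g.1, by grind, hg⟩

/-- The point `c` is the left end of a longest gap of `K` close to `a`. -/
lemma exists_mul_le_sub (hK : IsThickSpan τ K a b) (hτ : 0 < τ) (hη : 0 < η) :
    ∃ c ∈ K, c ∈ Ioo a (a + η) ∧ ∀ v ∈ K, a < v → v ≤ c → ∀ ℓ > 0,
      Disjoint (Ioo (v - ℓ) v) K → τ * ℓ ≤ c - v := by
  obtain ⟨c, hcK, hc⟩ := hK.exists_mem_Ioo hτ hη
  obtain ⟨g, ⟨hg, hgc⟩, hmax⟩ := ((isCompact_gapEndpoints hK.isCompact).inter_right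
    (isClosed_Iic.preimage continuous_snd : IsClosed (Prod.snd ⁻¹' Iic c))).exists_isMaxOn
    ⟨(a, a), ⟨⟨hK.isLeast.1, hK.isLeast.1⟩, by simp⟩, hc.1.le⟩
    (f := fun g : ℝ × ℝ => g.2 - g.1) (by fun_prop)
  have length_le {v ℓ : ℝ} (hv : v ∈ K) (hav : a < v) (hvc : v ≤ c) (hℓ : 0 < ℓ)
      (hd : Disjoint (Ioo (v - ℓ) v) K) : ℓ ≤ g.2 - g.1 := by
    obtain ⟨u, hu, huv⟩ := hK.exists_gap_of_disjoint_Ioo hv hav hℓ hd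
    have : v - u ≤ g.2 - g.1 := hmax ⟨huv, hvc⟩
    linarith
  rcases le_or_gt g.2 g.1 with hle | hlt
  · exact ⟨c, hcK, hc, fun v hv hav hvc ℓ hℓ hd => by linarith [length_le hv hav hvc hℓ hd]⟩
  have hag := hK.mul_gap_le_left hg hlt
  have hpos : 0 < τ * (g.2 - g.1) := mul_pos hτ (sub_pos.mpr hlt)
  have hgc' : g.2 ≤ c := hgc
  refine ⟨g.1, hg.1.1, ⟨by linarith, by linarith [hc.2]⟩, fun v hv hav hvg ℓ hℓ hd => ?_⟩
  have hℓg := length_le hv hav (by linarith) hℓ hd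
  exact hK.isThick v hv g.1 hg.1.1 hvg ℓ hℓ hd (hg.2.mono_left (Ioo_subset_Ioo_right (by linarith)))
    fun hsub => hav.not_ge (hsub hK.isLeast.1).1

lemma exists_short_left (hK : IsThickSpan τ K a b) (hτ : 0 < τ) (hη : 0 < η) :
    ∃ K' ⊆ K, ∃ c < a + η, IsThickSpan τ K' a c := by
  obtain ⟨c, hcK, ⟨hac, hcη⟩, hc⟩ := hK.exists_mul_le_sub hτ hη
  refine ⟨K ∩ Iic c, inter_subset_left, c, hcη, hK.isCompact.inter_right isClosed_Iic,
    ⟨⟨hK.isLeast.1, hac.le⟩, fun x hx => hK.isLeast.2 hx.1⟩,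
    ⟨⟨hcK, self_mem_Iic⟩, fun x hx => hx.2⟩, hac, fun v hv s hs hvs ℓ hℓ hdv hds hsub => ?_⟩
  have hdv' : Disjoint (Ioo (v - ℓ) v) K :=
    disjoint_left.mpr fun x hx hxK => disjoint_left.mp hdv hx ⟨hxK, hx.2.le.trans hv.2⟩
  rcases (mem_Iic.mp hs.2).eq_or_lt with rfl | hsc
  · refine hc v hv.1 ((hK.isLeast.2 hv.1).lt_of_ne ?_) hvs ℓ hℓ hdv'
    rintro rfl
    exact hsub fun x hx => ⟨hK.isLeast.2 hx.1, hx.2⟩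
  · have hsℓ : s + ℓ ≤ c :=
      (disjoint_Ioo_iff.mp hds c ⟨hcK, self_mem_Iic⟩).resolve_left hsc.not_ge
    exact hK.isThick v hv.1 s hs.1 hvs ℓ hℓ hdv'
      (disjoint_left.mpr fun x hx hxK => disjoint_left.mp hds hx ⟨hxK, hx.2.le.trans hsℓ⟩)
      fun hsub => hsc.not_ge (hsub hcK).2

lemma exists_subset_of_mem_nhds (hK : IsThickSpan τ K a b) (hτ : 0 < τ) {U : Set ℝ}
    (hU : U ∈ 𝓝 a) : ∃ K' ⊆ K, ∃ c, IsThickSpan τ K' a c ∧ K' ⊆ U := by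
  obtain ⟨η, hη, hηU⟩ := Metric.mem_nhds_iff.mp hU
  obtain ⟨K', hK', c, hc, h'⟩ := hK.exists_short_left hτ hη
  refine ⟨K', hK', c, h', fun x hx => hηU ?_⟩
  rw [Real.ball_eq_Ioo]
  exact ⟨by linarith [h'.isLeast.2 hx], (h'.isGreatest.2 hx).trans_lt hc⟩

lemma exists_short_right (hK : IsThickSpan τ K a b) (hτ : 0 < τ) (hη : 0 < η) :
    ∃ K' ⊆ K, ∃ c > b - η, IsThickSpan τ K' c b := by
  obtain ⟨K', hK', c, hc, h'⟩ := hK.neg.exists_short_left hτ hη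
  exact ⟨-K', by simpa using neg_subset_neg.mpr hK', -c, by linarith, by simpa using h'.neg⟩

lemma image (hK : IsThickSpan τ K a b) (hτ : 0 < τ) {φ : ℝ → ℝ} {l m M : ℝ} (hm : 0 < m)
    (hlM : l * M ≤ m) (hφ : ContinuousOn φ K)
    (hφK : ∀ x ∈ K, ∀ y ∈ K, x ≤ y → φ y - φ x ∈ Icc (m * (y - x)) (M * (y - x))) :
    IsThickSpan (l * τ) (φ '' K) (φ a) (φ b) := by
  have hmono : StrictMonoOn φ K := fun x hx y hy hxy =>
    sub_pos.mp ((mul_pos hm (sub_pos.mpr hxy)).trans_le (hφK x hx y hy hxy.le).1)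
  have hM : 0 < M := by
    have hab := hφK a hK.isLeast.1 b hK.isGreatest.1 hK.lt.le
    exact hm.trans_le (le_of_mul_le_mul_right (hab.1.trans hab.2) (sub_pos.mpr hK.lt))
  refine ⟨hK.isCompact.image_of_continuousOn hφ, hmono.monotoneOn.map_isLeast hK.isLeast,
    hmono.monotoneOn.map_isGreatest hK.isGreatest,
    hmono hK.isLeast.1 hK.isGreatest.1 hK.lt, ?_⟩
  rintro _ ⟨v, hv, rfl⟩ _ ⟨s, hs, rfl⟩ hvs ℓ hℓ hdv hds hsub
  have hvs' : v ≤ s := (hmono.le_iff_le hv hs).mp hvs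
  have div_le {x y : ℝ} (hx : x ∈ K) (hy : y ∈ K) (hxy : x ≤ y) (h : ℓ ≤ φ y - φ x) :
      ℓ / M ≤ y - x := (div_le_iff₀' hM).mpr (h.trans (hφK x hx y hy hxy).2)
  have hdv' : Disjoint (Ioo (v - ℓ / M) v) K := disjoint_left.mpr fun x hx hxK => by
    have hφx := hmono hxK hv hx.2
    have := disjoint_Ioo_iff.mp hdv (φ x) (mem_image_of_mem φ hxK)
    linarith [hx.1, div_le hxK hv hx.2.le (by grind)]
  have hds' : Disjoint (Ioo s (s + ℓ / M)) K := disjoint_left.mpr fun x hx hxK => by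
    have hφx := hmono hs hxK hx.1
    have := disjoint_Ioo_iff.mp hds (φ x) (mem_image_of_mem φ hxK)
    linarith [hx.2, div_le hs hxK hx.1.le (by grind)]
  have thick := hK.isThick v hv s hs hvs' (ℓ / M) (div_pos hℓ hM) hdv' hds'
    fun hsub' => hsub (image_subset_iff.mpr fun x hx =>
      ⟨hmono.monotoneOn hv hx (hsub' hx).1, hmono.monotoneOn hx hs (hsub' hx).2⟩)
  calc l * τ * ℓ = l * M * (τ * (ℓ / M)) := by field_simp
    _ ≤ m * (s - v) := by gcongr
    _ ≤ φ s - φ v := (hφK v hv s hs hvs').1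

lemma exists_shorter_gap_right (hK : IsThickSpan τ K a b) (hg : g ∈ gapEndpoints K)
    (hlt : g.1 < g.2) (hw : g.2 ≤ w) (hwK : w ∉ K) (hwg : w - g.2 < τ * (g.2 - g.1)) :
    ∃ g' ∈ gapEndpoints K, g.2 ≤ g'.1 ∧ g'.1 < w ∧ w < g'.2 ∧ g'.2 - g'.1 < g.2 - g.1 := by
  have hwb : w ≤ b := by linarith [hK.mul_gap_le_right hg hlt]
  obtain ⟨g', hg', hgg', hg'w, hwg', -⟩ := exists_gapEndpoints_of_notMem hK.isCompact.isClosed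
    hg.1.2 hK.isGreatest.1 ⟨hw, hwb⟩ hwK
  refine ⟨g', hg', hgg', hg'w, hwg', ?_⟩
  by_contra! hcon
  have := hK.isThick g.2 hg.1.2 g'.1 hg'.1.1 hgg' (g.2 - g.1) (sub_pos.mpr hlt)
    (by rw [sub_sub_cancel]; exact hg.2)
    (hg'.2.mono_left (Ioo_subset_Ioo_right (by linarith)))
    fun hsub => hlt.not_ge (hsub hg.1.1).1
  linarith

lemma exists_shorter_gap_left (hK : IsThickSpan τ K a b) (hg : g ∈ gapEndpoints K)
    (hlt : g.1 < g.2) (hw : w ≤ g.1) (hwK : w ∉ K) (hwg : g.1 - w < τ * (g.2 - g.1)) :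
    ∃ g' ∈ gapEndpoints K, g'.1 < w ∧ w < g'.2 ∧ g'.2 ≤ g.1 ∧ g'.2 - g'.1 < g.2 - g.1 := by
  obtain ⟨g', hg', h₁, h₂, h₃, h₄⟩ := hK.neg.exists_shorter_gap_right (g := (-g.2, -g.1)) (w := -w)
    (by simpa [mem_gapEndpoints_neg] using hg) (neg_lt_neg hlt) (neg_le_neg hw) (by simpa using hwK)
    (by dsimp only; linarith)
  dsimp only at h₁ h₄
  exact ⟨(-g'.2, -g'.1), mem_gapEndpoints_neg.mp hg', by linarith, by linarith, by linarith,
    by dsimp only; linarith⟩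

end IsThickSpan

/-- The pairs of a gap of `A` and a gap of `B` such that the gap of `A` starts first, they overlap,
and the gap of `B` ends last. -/
def linkedGaps (A B : Set ℝ) : Set ((ℝ × ℝ) × (ℝ × ℝ)) :=
  gapEndpoints A ×ˢ gapEndpoints B ∩ {p | p.1.1 ≤ p.2.1 ∧ p.2.1 ≤ p.1.2 ∧ p.1.2 ≤ p.2.2}

lemma isCompact_linkedGaps {A B : Set ℝ} (hA : IsCompact A) (hB : IsCompact B) :
    IsCompact (linkedGaps A B) := by
  refine ((isCompact_gapEndpoints hA).prod (isCompact_gapEndpoints hB)).inter_right ?_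
  simp only [ofPred_and]
  exact (isClosed_le (by fun_prop) (by fun_prop)).inter
    ((isClosed_le (by fun_prop) (by fun_prop)).inter (isClosed_le (by fun_prop) (by fun_prop)))

namespace IsThickSpan

variable {τ₁ τ₂ a₁ b₁ a₂ b₂ : ℝ} {A B : Set ℝ}

/-- Since `τ₁ * τ₂ > 1`, one of the two gaps is shorter than the segment free of long gaps which
thickness forces next to the other one, and the latter can be replaced by a shorter gap. -/
lemma exists_linkedGaps_lt (hA : IsThickSpan τ₁ A a₁ b₁) (hB : IsThickSpan τ₂ B a₂ b₂)
    (hτ₁ : 0 < τ₁) (hτ : 1 < τ₁ * τ₂) (hd : Disjoint A B) {g h : ℝ × ℝ}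
    (hgh : (g, h) ∈ linkedGaps A B) :
    ∃ h' g', (h', g') ∈ linkedGaps B A ∧
      (h'.2 - h'.1) + (g'.2 - g'.1) < (g.2 - g.1) + (h.2 - h.1) := by
  obtain ⟨⟨hg, hh⟩, h₁, h₂, h₃⟩ := hgh
  dsimp only at hg hh h₁ h₂ h₃
  have hlt₁ := h₁.lt_of_ne (hd.ne_of_mem hg.1.1 hh.1.1)
  have hlt₂ := h₂.lt_of_ne' (hd.ne_of_mem hg.1.2 hh.1.1)
  have hlt₃ := h₃.lt_of_ne (hd.ne_of_mem hg.1.2 hh.1.2)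
  rcases lt_or_ge (h.2 - h.1) (τ₁ * (g.2 - g.1)) with hcase | hcase
  · obtain ⟨g', hg', h₄, h₅, h₆, h₇⟩ := hA.exists_shorter_gap_right hg (hlt₁.trans hlt₂) h₃
      (disjoint_right.mp hd hh.1.2) (by linarith)
    exact ⟨h, g', ⟨⟨hh, hg'⟩, by linarith, h₅.le, h₆.le⟩, by linarith⟩
  · have hτ₂ : 0 < τ₂ := pos_of_mul_pos_right (one_pos.trans hτ) hτ₁.le
    have hcase' : g.2 - g.1 < τ₂ * (h.2 - h.1) := by
      calc g.2 - g.1 < τ₁ * τ₂ * (g.2 - g.1) := lt_mul_of_one_lt_left (by linarith) hτ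
        _ = τ₂ * (τ₁ * (g.2 - g.1)) := by ring
        _ ≤ τ₂ * (h.2 - h.1) := by gcongr
    obtain ⟨h', hh', h₄, h₅, h₆, h₇⟩ := hB.exists_shorter_gap_left hh (hlt₂.trans hlt₃) h₁
      (disjoint_left.mp hd hg.1.1) (by linarith)
    exact ⟨h', g, ⟨⟨hh', hg⟩, h₄.le, h₅.le, by linarith⟩, by linarith⟩

lemma not_disjoint_of_linkedGaps_nonempty (hA : IsThickSpan τ₁ A a₁ b₁)
    (hB : IsThickSpan τ₂ B a₂ b₂) (hτ₁ : 0 < τ₁) (hτ : 1 < τ₁ * τ₂)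
    (hAB : (linkedGaps A B).Nonempty) : ¬ Disjoint A B := by
  intro hd
  obtain ⟨⟨g, h⟩, hgh, hmin⟩ := (isCompact_linkedGaps hA.isCompact hB.isCompact).exists_isMinOn hAB
    (f := fun p => (p.1.2 - p.1.1) + (p.2.2 - p.2.1)) (by fun_prop)
  obtain ⟨h', g', hh', hlt'⟩ := hA.exists_linkedGaps_lt hB hτ₁ hτ hd hgh
  obtain ⟨g'', h'', hg'', hlt''⟩ := hB.exists_linkedGaps_lt hA
    (pos_of_mul_pos_right (one_pos.trans hτ) hτ₁.le) (by rwa [mul_comm]) hd.symm hh'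
  exact (hlt''.trans hlt').not_ge (hmin hg'')

lemma not_disjoint_of_le (hA : IsThickSpan τ₁ A a₁ b₁) (hB : IsThickSpan τ₂ B a₂ b₂)
    (hτ₁ : 0 < τ₁) (hτ : 1 < τ₁ * τ₂) (h₁ : a₁ ≤ a₂) (h₂ : a₂ ≤ b₁)
    (h₃ : a₂ - a₁ < τ₁ * (b₂ - a₂)) : ¬ Disjoint A B := by
  intro hd
  obtain ⟨g, hg, -, hga₂, ha₂g, -⟩ := exists_gapEndpoints_of_notMem hA.isCompact.isClosed
    hA.isLeast.1 hA.isGreatest.1 ⟨h₁, h₂⟩ (disjoint_right.mp hd hB.isLeast.1)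
  have hgb₂ : g.2 - g.1 < b₂ - a₂ :=
    lt_of_mul_lt_mul_left (by linarith [hA.mul_gap_le_left hg (hga₂.trans ha₂g)]) hτ₁.le
  obtain ⟨h, hh, hah, hhg, hgh, -⟩ := exists_gapEndpoints_of_notMem hB.isCompact.isClosed
    hB.isLeast.1 hB.isGreatest.1 ⟨ha₂g.le, by linarith⟩ (disjoint_left.mp hd hg.1.2)
  exact not_disjoint_of_linkedGaps_nonempty hA hB hτ₁ hτ
    ⟨(g, h), ⟨hg, hh⟩, by linarith, hhg.le, hgh.le⟩ hd

lemma not_disjoint (hA : IsThickSpan τ₁ A a₁ b₁) (hB : IsThickSpan τ₂ B a₂ b₂)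
    (hτ₁ : 0 < τ₁) (hτ : 1 < τ₁ * τ₂) (h₁ : a₁ ≤ b₂) (h₂ : a₂ ≤ b₁)
    (h₃ : a₂ - a₁ < τ₁ * (b₂ - a₂)) (h₄ : a₁ - a₂ < τ₂ * (b₁ - a₁)) : ¬ Disjoint A B := by
  rcases le_total a₁ a₂ with h | h
  · exact hA.not_disjoint_of_le hB hτ₁ hτ h h₂ h₃
  · rw [disjoint_comm]
    exact hB.not_disjoint_of_le hA (pos_of_mul_pos_right (one_pos.trans hτ) hτ₁.le)
      (by rwa [mul_comm]) h h₁ h₄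

end IsThickSpan

lemma exists_mem_Ioo_one_lt_mul_mul_mul {x y : ℝ} (h : 1 < x * y) :
    ∃ l ∈ Ioo (0 : ℝ) 1, 1 < (l * x) * (l * y) := by
  have hcont : ContinuousAt (fun l : ℝ => (l * x) * (l * y)) 1 := by fun_prop
  have hgt := hcont.tendsto.eventually_const_lt (u := 1) (by simpa using h)
  obtain ⟨l, hl, hl'⟩ := ((hgt.filter_mono nhdsWithin_le_nhds).and
    (Ioo_mem_nhdsLT zero_lt_one)).exists
  exact ⟨l, hl', hl⟩

variable {Z : Type*} [NormedAddCommGroup Z] [NormedSpace ℝ Z]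

lemma eventually_sub_mem_Icc_of_contDiffAt {f : Z × ℝ → ℝ} {z₀ : Z} {p c : ℝ}
    (hf : ContDiffAt ℝ 1 f (z₀, p)) (hc : 0 < c) :
    ∃ U ∈ 𝓝 p, ∀ᶠ z in 𝓝 z₀, ∀ x ∈ U, ∀ y ∈ U, x ≤ y → f (z, y) - f (z, x) ∈
      Icc ((deriv (fun x => f (z₀, x)) p - c) * (y - x))
        ((deriv (fun x => f (z₀, x)) p + c) * (y - x)) := by
  lift c to NNReal using hc.le
  have hf' := hf.hasStrictFDerivAt one_ne_zero
  have hderiv : deriv (fun x => f (z₀, x)) p = fderiv ℝ f (z₀, p) (0, 1) :=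
    (hf'.hasFDerivAt.comp_hasDerivAt p ((hasDerivAt_const p z₀).prodMk (hasDerivAt_id p))).deriv
  obtain ⟨W, hW, hfW⟩ := hf'.approximates_deriv_on_nhds (.inr (NNReal.coe_pos.mp hc))
  rw [nhds_prod_eq, mem_prod_iff] at hW
  obtain ⟨S, hS, U, hU, hSU⟩ := hW
  refine ⟨U, hU, mem_of_superset hS fun z hz x hx y hy hxy => ?_⟩
  have happrox := hfW (z, y) (hSU (mk_mem_prod hz hy)) (z, x) (hSU (mk_mem_prod hz hx))
  have hmap : fderiv ℝ f (z₀, p) ((z, y) - (z, x)) = (y - x) * fderiv ℝ f (z₀, p) (0, 1) := by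
    rw [← smul_eq_mul, ← map_smul]
    simp
  rw [hmap, ← hderiv, Prod.mk_sub_mk, sub_self, Prod.norm_mk, norm_zero,
    max_eq_right (norm_nonneg _), Real.norm_eq_abs, Real.norm_eq_abs,
    abs_of_nonneg (sub_nonneg.mpr hxy), abs_le] at happrox
  constructor <;> linarith [happrox.1, happrox.2]

lemma eventually_isThickSpan_image {f : Z × ℝ → ℝ} {z₀ : Z} {p τ l : ℝ} (hf : ContDiff ℝ 1 f)
    (hfp : 0 < deriv (fun x => f (z₀, x)) p) (hτ : 0 < τ) (hl : l ∈ Ioo (0 : ℝ) 1) :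
    ∃ U ∈ 𝓝 p, ∀ K ⊆ U, ∀ a b, IsThickSpan τ K a b → ∀ᶠ z in 𝓝 z₀,
      IsThickSpan (l * τ) ((fun x => f (z, x)) '' K) (f (z, a)) (f (z, b)) := by
  have hf_cont := hf.continuous
  let α := deriv (fun x => f (z₀, x)) p
  -- The choice of `c` makes `l * (α + c) = α - c`.
  let c := α * (1 - l) / (1 + l)
  have hl₁ : 0 < 1 - l := sub_pos.mpr hl.2
  have hl₂ : 0 < 1 + l := by linarith [hl.1]
  obtain ⟨U, hU, hfU⟩ := eventually_sub_mem_Icc_of_contDiffAt (c := c) hf.contDiffAt (by positivity)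
  have hαc : α - c = 2 * l * α / (1 + l) := by simp only [c]; field_simp; ring
  have hlc : l * (α + c) ≤ α - c := by
    refine le_of_eq ?_
    simp only [c]; field_simp; ring
  refine ⟨U, hU, fun K hKU a b hK => hfU.mono fun z hz => hK.image hτ (m := α - c) (M := α + c)
    ?_ hlc (by fun_prop) fun x hx y hy => hz x (hKU hx) y (hKU hy)⟩
  have := hl.1
  rw [hαc]
  positivity

lemma eventually_exists_eq {f g : Z × ℝ → ℝ} {z₀ : Z} {p q τ₁ τ₂ p' q' : ℝ} {K₁ K₂ U V : Set ℝ}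
    (hK₁ : IsThickSpan τ₁ K₁ p p') (hK₂ : IsThickSpan τ₂ K₂ q q') (hτ₁ : 0 < τ₁)
    (hτ : 1 < τ₁ * τ₂) (hf : ContDiff ℝ 1 f) (hg : ContDiff ℝ 1 g)
    (hfp : 0 < deriv (fun x => f (z₀, x)) p) (hgq : 0 < deriv (fun x => g (z₀, x)) q)
    (hfg : f (z₀, p) = g (z₀, q)) (hU : U ∈ 𝓝 p) (hV : V ∈ 𝓝 q) :
    ∀ᶠ z in 𝓝 z₀, ∃ x ∈ K₁ ∩ U, ∃ y ∈ K₂ ∩ V, f (z, x) = g (z, y) := by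
  obtain ⟨l, hl, hlτ⟩ := exists_mem_Ioo_one_lt_mul_mul_mul hτ
  have hτ₂ : 0 < τ₂ := pos_of_mul_pos_right (one_pos.trans hτ) hτ₁.le
  obtain ⟨U', hU', hfU'⟩ := eventually_isThickSpan_image hf hfp hτ₁ hl
  obtain ⟨V', hV', hgV'⟩ := eventually_isThickSpan_image hg hgq hτ₂ hl
  obtain ⟨A, hAK, a, hA, hAU⟩ := hK₁.exists_subset_of_mem_nhds hτ₁ (inter_mem hU hU')
  obtain ⟨B, hBK, b, hB, hBV⟩ := hK₂.exists_subset_of_mem_nhds hτ₂ (inter_mem hV hV')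
  have hfA := hfU' A (fun x hx => (hAU hx).2) p a hA
  have hgB := hgV' B (fun x hx => (hBV hx).2) q b hB
  have hf_lt : f (z₀, p) < f (z₀, a) := hfA.self_of_nhds.lt
  have hg_lt : g (z₀, q) < g (z₀, b) := hgB.self_of_nhds.lt
  have hf_cont := hf.continuous
  have hg_cont := hg.continuous
  have hlτ₁ : 0 < l * τ₁ := mul_pos hl.1 hτ₁
  have hlτ₂ : 0 < l * τ₂ := mul_pos hl.1 hτ₂
  have h₁ : ∀ᶠ z in 𝓝 z₀, f (z, p) < g (z, b) :=
    ContinuousAt.eventually_lt (by fun_prop) (by fun_prop) (by linarith)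
  have h₂ : ∀ᶠ z in 𝓝 z₀, g (z, q) < f (z, a) :=
    ContinuousAt.eventually_lt (by fun_prop) (by fun_prop) (by linarith)
  have h₃ : ∀ᶠ z in 𝓝 z₀, g (z, q) - f (z, p) < l * τ₁ * (g (z, b) - g (z, q)) :=
    ContinuousAt.eventually_lt (by fun_prop) (by fun_prop) <| by
      rw [hfg, sub_self]
      exact mul_pos hlτ₁ (sub_pos.mpr hg_lt)
  have h₄ : ∀ᶠ z in 𝓝 z₀, f (z, p) - g (z, q) < l * τ₂ * (f (z, a) - f (z, p)) :=
    ContinuousAt.eventually_lt (by fun_prop) (by fun_prop) <| by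
      rw [← hfg, sub_self]
      exact mul_pos hlτ₂ (sub_pos.mpr hf_lt)
  filter_upwards [hfA, hgB, h₁, h₂, h₃, h₄] with z hfA hgB h₁ h₂ h₃ h₄
  obtain ⟨_, ⟨x, hx, rfl⟩, y, hy, hxy⟩ :=
    not_disjoint_iff.mp (hfA.not_disjoint hgB hlτ₁ hlτ h₁.le h₂.le h₃ h₄)
  exact ⟨x, ⟨hAK hx, (hAU hx).1⟩, y, ⟨hBK hy, (hBV hy).1⟩, hxy.symm⟩

end ThickSubsetsOfTheLine

section ThicknessOfLines

variable {X : Type*} [MetricSpace X] (e : ℝ ≃ᵢ X) {C : Set X} {x y u v : ℝ}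

include e

lemma uIcc_subset_of_joinedIn {F : Set X} (h : JoinedIn F (e x) (e y)) :
    uIcc x y ⊆ e ⁻¹' F := by
  have hconn : IsPreconnected (e ⁻¹' pathComponentIn F (e x)) :=
    e.toHomeomorph.isPreconnected_preimage.mpr
      (isPathConnected_pathComponentIn h.source_mem).isConnected.isPreconnected
  exact (hconn.ordConnected.uIcc_subset (mem_pathComponentIn_self h.source_mem) h).trans
    (preimage_mono pathComponentIn_subset)

lemma isBounded_pathComponentIn_compl (hu : e u ∈ C) (hv : e v ∈ C) (hx : x ∈ Icc u v) :
    Bornology.IsBounded (pathComponentIn Cᶜ (e x)) := by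
  refine (e.isometry.lipschitz.isBounded_image (isBounded_Icc u v)).subset fun y hy => ?_
  obtain ⟨y, rfl⟩ := e.surjective y
  have hxy := uIcc_subset_of_joinedIn e hy
  refine mem_image_of_mem e ⟨?_, ?_⟩
  · by_contra! hyu
    exact hxy (mem_uIcc.mpr (.inr ⟨hyu.le, hx.1⟩)) hu
  · by_contra! hvy
    exact hxy (mem_uIcc.mpr (.inl ⟨hx.2, hvy.le⟩)) hv

lemma ofReal_sub_le_ediam_pathComponentIn_compl (hd : Disjoint (Ioo u v) (e ⁻¹' C))
    (hx : x ∈ Ioo u v) : ENNReal.ofReal (v - u) ≤ ediam (pathComponentIn Cᶜ (e x)) := by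
  rw [← Real.ediam_Ioo, ← e.isometry.ediam_image]
  exact ediam_mono (((convex_Ioo u v).isPathConnected ⟨x, hx⟩ |>.image
    e.continuous).subset_pathComponentIn (mem_image_of_mem e hx)
    (image_subset_iff.mpr hd.subset_compl_right))

lemma isThick_preimage {τ : ℝ} (hτ : 0 ≤ τ) (h : ENNReal.ofReal τ ≤ thickness C) :
    IsThick τ (e ⁻¹' C) := by
  intro v hv s hs hvs ℓ hℓ hdv hds hsub
  refine le_of_forall_pos_lt_add' fun ε hε => ?_
  obtain ⟨κ, hκ, hκℓε⟩ := exists_between (lt_min hℓ (half_pos hε))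
  obtain ⟨hκℓ, hκε⟩ := lt_min_iff.mp hκℓε
  have hx : v - κ ∈ Ioo (v - ℓ) v := ⟨by linarith, by linarith⟩
  have hy : s + κ ∈ Ioo s (s + ℓ) := ⟨by linarith, by linarith⟩
  have hxy : ¬ JoinedIn Cᶜ (e (v - κ)) (e (s + κ)) := fun hxy =>
    uIcc_subset_of_joinedIn e hxy (mem_uIcc.mpr (.inl ⟨hx.2.le, by linarith⟩)) hv
  have hb : Bornology.IsBounded (pathComponentIn Cᶜ (e (v - κ))) ∨
      Bornology.IsBounded (pathComponentIn Cᶜ (e (s + κ))) := by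
    obtain ⟨k, hk, hkvs⟩ := not_subset.mp hsub
    rcases lt_or_ge k v with hkv | hkv
    · have := (disjoint_Ioo_iff.mp hdv k hk).resolve_right hkv.not_ge
      exact .inl (isBounded_pathComponentIn_compl e hk hv ⟨this.trans hx.1.le, hx.2.le⟩)
    · have hsk : s < k := not_le.mp fun hks => hkvs ⟨hkv, hks⟩
      have := (disjoint_Ioo_iff.mp hds k hk).resolve_left hsk.not_ge
      exact .inr (isBounded_pathComponentIn_compl e hs hk ⟨hy.1.le, hy.2.le.trans this⟩)
  have hℓx := ofReal_sub_le_ediam_pathComponentIn_compl e hdv hx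
  have hℓy := ofReal_sub_le_ediam_pathComponentIn_compl e hds hy
  rw [sub_sub_cancel] at hℓx
  rw [add_sub_cancel_left] at hℓy
  have key : ENNReal.ofReal (τ * ℓ) ≤ ENNReal.ofReal (s - v + 2 * κ) := calc
    _ = ENNReal.ofReal τ * ENNReal.ofReal ℓ := ENNReal.ofReal_mul hτ
    _ ≤ _ := mul_le_mul' h (le_min hℓx hℓy)
    _ ≤ _ := thickness_mul_min_ediam_le_edist (disjoint_left.mp hdv hx) (disjoint_left.mp hds hy)
      hxy hb
    _ = _ := by
      rw [e.isometry.edist_eq, edist_dist, Real.dist_eq, abs_sub_comm, abs_of_nonneg (by linarith)]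
      congr 1
      ring
  linarith [(ENNReal.ofReal_le_ofReal_iff (by linarith)).mp key]

end ThicknessOfLines

section ProductsOnThePlane

/-- `p` is the smallest element of a compact subset of `D` satisfying `IsThick τ`. -/
def IsThickLeftEnd (τ : ℝ) (D : Set ℝ) (p : ℝ) : Prop :=
  ∃ K ⊆ D, ∃ q, IsThickSpan τ K p q

namespace IsThickLeftEnd

variable {τ δ p : ℝ} {D : Set ℝ}

lemma mem (h : IsThickLeftEnd τ D p) : p ∈ D := by
  obtain ⟨K, hK, q, h⟩ := h
  exact hK h.isLeast.1

lemma exists_gt (h : IsThickLeftEnd τ D p) (hτ : 0 < τ) (hδ : 0 < δ) :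
    ∃ q ∈ Ioo p (p + δ), IsThickLeftEnd τ D q := by
  obtain ⟨K, hK, r, h⟩ := h
  obtain ⟨K', hK', c, hc, h'⟩ := h.exists_short_left hτ hδ
  obtain ⟨K'', hK'', q, hq, h''⟩ := h'.exists_short_right hτ (sub_pos.mpr h'.lt)
  exact ⟨q, ⟨by linarith, h''.lt.trans hc⟩, K'', hK''.trans (hK'.trans hK), c, h''⟩

lemma exists_lt_of_neg (h : IsThickLeftEnd τ (-D) (-p)) (hτ : 0 < τ) (hδ : 0 < δ) :
    ∃ q ∈ Ioo (p - δ) p, IsThickLeftEnd τ D q := by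
  obtain ⟨K, hK, r, h⟩ := h
  obtain ⟨K', hK', c, hc, h'⟩ := h.exists_short_left hτ hδ
  have hneg := h'.neg
  rw [neg_neg] at hneg
  exact ⟨-c, ⟨by linarith, by linarith [h'.lt]⟩, -K', by
    simpa using neg_subset_neg.mpr (hK'.trans hK), p, hneg⟩

end IsThickLeftEnd

lemma eventually_exists_sq_add_sq_eq {τ₁ τ₂ p q x₁ x₂ t : ℝ} {D₁ D₂ U V : Set ℝ} (hτ₁ : 0 < τ₁)
    (hτ : 1 < τ₁ * τ₂) (hp : IsThickLeftEnd τ₁ D₁ p) (hq : IsThickLeftEnd τ₂ D₂ q)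
    (hxp : x₁ < p) (hqx : q < x₂) (hU : U ∈ 𝓝 p) (hV : V ∈ 𝓝 q)
    (ht : (p - x₁) ^ 2 + (q - x₂) ^ 2 = t ^ 2) :
    ∀ᶠ z in 𝓝 (x₁, x₂, t), ∃ a ∈ D₁ ∩ U, ∃ b ∈ D₂ ∩ V,
      (a - z.1) ^ 2 + (b - z.2.1) ^ 2 = z.2.2 ^ 2 := by
  obtain ⟨K₁, hK₁D, p', hK₁⟩ := hp
  obtain ⟨K₂, hK₂D, q', hK₂⟩ := hq
  refine (eventually_exists_eq hK₁ hK₂ hτ₁ hτ (f := fun w => (w.2 - w.1.1) ^ 2)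
    (g := fun w => w.1.2.2 ^ 2 - (w.2 - w.1.2.1) ^ 2) (by fun_prop) (by fun_prop) ?_ ?_
    (by dsimp only; linarith) hU hV).mono fun z ⟨a, ha, b, hb, hab⟩ =>
      ⟨a, ⟨hK₁D ha.1, ha.2⟩, b, ⟨hK₂D hb.1, hb.2⟩, by linarith⟩
  · have : HasDerivAt (fun a => (a - x₁) ^ 2) (2 * (p - x₁)) p := by
      simpa using ((hasDerivAt_id p).sub_const x₁).fun_pow 2
    rw [this.deriv]
    linarith
  · have : HasDerivAt (fun b => t ^ 2 - (b - x₂) ^ 2) (-(2 * (q - x₂))) q := by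
      simpa using (((hasDerivAt_id q).sub_const x₂).fun_pow 2).const_sub (t ^ 2)
    rw [this.deriv]
    linarith

open Complex in
lemma eventually_exists_dist_eq {τ₁ τ₂ σ : ℝ} {D₁ D₂ : Set ℝ} {s s' : ℂ} (hτ₁ : 0 < τ₁)
    (hτ : 1 < τ₁ * τ₂) (hσ : σ * σ = 1) (hre : IsThickLeftEnd τ₁ D₁ s'.re)
    (him : IsThickLeftEnd τ₂ ((σ * ·) ⁻¹' D₂) (σ * s'.im)) (hlt_re : s.re < s'.re)
    (hlt_im : σ * s'.im < σ * s.im) {A : Set ℂ} (hA : A ∈ 𝓝[D₁ ×ℂ D₂] s') :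
    ∀ᶠ w : ℂ × ℝ in 𝓝 (s, dist s s'), ∃ y ∈ A, dist w.1 y = w.2 := by
  have sq_mul (x : ℝ) : (σ * x) ^ 2 = x ^ 2 := by rw [mul_pow, sq σ, hσ, one_mul]
  have sq_dist (z y : ℂ) : dist z y ^ 2 = (y.re - z.re) ^ 2 + (σ * y.im - σ * z.im) ^ 2 := by
    rw [dist_comm, dist_eq_re_im, Real.sq_sqrt (by positivity), ← mul_sub, sq_mul]
  obtain ⟨O, hO, hOA⟩ := mem_nhdsWithin_iff_exists_mem_nhds_inter.mp hA
  have hcont : Continuous fun x : ℝ × ℝ => (⟨x.1, σ * x.2⟩ : ℂ) :=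
    equivRealProdCLM.symm.continuous.comp (by fun_prop : Continuous fun x : ℝ × ℝ => (x.1, σ * x.2))
  have hO' : (fun x : ℝ × ℝ => (⟨x.1, σ * x.2⟩ : ℂ)) ⁻¹' O ∈ 𝓝 (s'.re, σ * s'.im) :=
    hcont.continuousAt.preimage_mem_nhds (by rwa [← mul_assoc, hσ, one_mul])
  rw [nhds_prod_eq, mem_prod_iff] at hO'
  obtain ⟨U, hU, V, hV, hUV⟩ := hO'
  have hev := eventually_exists_sq_add_sq_eq hτ₁ hτ hre him hlt_re hlt_im hU hV (sq_dist s s').symm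
  have hw : Continuous fun w : ℂ × ℝ => (w.1.re, σ * w.1.im, w.2) := by fun_prop
  have hpos : ∀ᶠ w : ℂ × ℝ in 𝓝 (s, dist s s'), 0 < w.2 :=
    continuousAt_snd.eventually_const_lt (dist_pos.mpr fun h => hlt_re.ne (congrArg re h))
  filter_upwards [hw.continuousAt.eventually hev, hpos] with w ⟨a, ha, b, hb, hab⟩ hw
  refine ⟨⟨a, σ * b⟩, hOA ⟨hUV (mk_mem_prod ha.2 hb.2), ha.1, hb.1⟩, ?_⟩
  rw [← sq_eq_sq₀ dist_nonneg hw.le, sq_dist, ← mul_assoc, hσ, one_mul]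
  exact hab

/-- The points of `D₁ ×ℂ D₂` whose real part is a thick left end of `D₁` and whose imaginary part
is a thick left end (`σ = 1`) or right end (`σ = -1`) of `D₂`. -/
def thickCorners (τ₁ τ₂ : ℝ) (D₁ D₂ : Set ℝ) : Set (ℂ × ℝ) :=
  {s | s.2 * s.2 = 1 ∧ IsThickLeftEnd τ₁ D₁ s.1.re ∧
    IsThickLeftEnd τ₂ ((s.2 * ·) ⁻¹' D₂) (s.2 * s.1.im)}

lemma mem_reProdIm_of_mem_thickCorners {τ₁ τ₂ : ℝ} {D₁ D₂ : Set ℝ} {s : ℂ × ℝ}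
    (hs : s ∈ thickCorners τ₁ τ₂ D₁ D₂) : s.1 ∈ D₁ ×ℂ D₂ := by
  obtain ⟨hσ, hre, him⟩ := hs
  exact ⟨hre.mem, by simpa [← mul_assoc, hσ] using him.mem⟩

/-- From a corner we move to a nearby one to its right whose second coordinate is a thick end of the
opposite kind. Seen from the old corner, `(a - x₁)² + (b - x₂)² = t²` then equates two functions of
`a` and of `b` that both increase into the thick sets, so that the gap lemma applies. -/
lemma propagatesDistances_thickCorners {τ₁ τ₂ : ℝ} {D₁ D₂ : Set ℝ} (hτ₁ : 0 < τ₁)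
    (hτ : 1 < τ₁ * τ₂) :
    PropagatesDistances fun s : thickCorners τ₁ τ₂ D₁ D₂ => 𝓝[D₁ ×ℂ D₂] s.1.1 := by
  rintro ⟨⟨s, σ⟩, hσ, hre, him⟩ δ hδ
  dsimp only at hσ hre him
  have hτ₂ : 0 < τ₂ := pos_of_mul_pos_right (one_pos.trans hτ) hτ₁.le
  have hneg : IsThickLeftEnd τ₂ (-((-σ * ·) ⁻¹' D₂)) (-(-σ * s.im)) := by
    convert him using 1
    · ext x
      simp
    · ring
  obtain ⟨p, hp, hpD⟩ := hre.exists_gt hτ₁ (half_pos hδ)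
  obtain ⟨q, hq, hqD⟩ := hneg.exists_lt_of_neg hτ₂ (half_pos hδ)
  have hσ' : -σ * -σ = 1 := by rw [neg_mul_neg, hσ]
  have hq' : -σ * (-σ * q) = q := by rw [← mul_assoc, hσ', one_mul]
  have hs' : (⟨⟨p, -σ * q⟩, -σ⟩ : ℂ × ℝ) ∈ thickCorners τ₁ τ₂ D₁ D₂ :=
    ⟨hσ', hpD, by rwa [hq']⟩
  have hlt_im : -σ * (-σ * q) < -σ * s.im := by rw [hq']; exact hq.2
  refine ⟨⟨_, hs'⟩, dist s ⟨p, -σ * q⟩, ⟨dist_pos.mpr fun h => hp.1.ne (congrArg Complex.re h), ?_⟩,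
    fun A hA => ?_⟩
  · have hre_lt : |s.re - p| < δ / 2 := by
      rw [abs_sub_lt_iff]
      constructor <;> linarith [hp.1, hp.2]
    have him_lt : |s.im - -σ * q| < δ / 2 := by
      rw [abs_sub_lt_iff]
      rcases mul_self_eq_one_iff.mp hσ with rfl | rfl <;>
        constructor <;> linarith [hq.1, hq.2]
    rw [Complex.dist_eq]
    exact (Complex.norm_le_abs_re_add_abs_im _).trans_lt
      ((add_lt_add hre_lt him_lt).trans_eq (add_halves δ))
  · refine (eventually_exists_dist_eq hτ₁ hτ hσ' hs'.2.1 hs'.2.2 hp.1 hlt_im hA).filter_mono ?_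
    rw [nhds_prod_eq]
    exact prod_mono_left _ nhdsWithin_le_nhds

lemma interior_graphDistanceSet_reProdIm_nonempty {τ₁ τ₂ : ℝ} {D₁ D₂ : Set ℝ} {p q : ℝ}
    (hτ₁ : 0 < τ₁) (hτ : 1 < τ₁ * τ₂) (hp : IsThickLeftEnd τ₁ D₁ p) (hq : IsThickLeftEnd τ₂ D₂ q)
    {V : Type*} [Finite V] {T : SimpleGraph V} (hT : T.IsTree) :
    (interior (graphDistanceSet T (D₁ ×ℂ D₂))).Nonempty := by
  have : Nonempty (thickCorners τ₁ τ₂ D₁ D₂) :=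
    ⟨⟨⟨p, q⟩, 1⟩, by simpa [thickCorners] using ⟨hp, hq⟩⟩
  have (s : thickCorners τ₁ τ₂ D₁ D₂) : (𝓝[D₁ ×ℂ D₂] s.1.1).NeBot :=
    mem_closure_iff_nhdsWithin_neBot.mp (subset_closure (mem_reProdIm_of_mem_thickCorners s.2))
  exact interior_graphDistanceSet_nonempty (propagatesDistances_thickCorners hτ₁ hτ)
    (fun _ => self_mem_nhdsWithin) hT

lemma exists_isThickLeftEnd_preimage {X : Type*} [MetricSpace X] (e : ℝ ≃ᵢ X) {C : Set X}
    (hC : IsCompact C) (hnt : C.Nontrivial) {τ : ℝ} (hτ : 0 ≤ τ)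
    (h : ENNReal.ofReal τ ≤ thickness C) : ∃ p, IsThickLeftEnd τ (e ⁻¹' C) p := by
  obtain ⟨p, q, hpq⟩ := (isThick_preimage e hτ h).exists_isThickSpan
    (e.toHomeomorph.isCompact_preimage.mpr hC) (hnt.preimage e.surjective)
  exact ⟨p, _, subset_rfl, q, hpq⟩

lemma interior_graphDistanceSet_euclideanProd_nonempty_of_one
    {C₁ C₂ : Set (EuclideanSpace ℝ (Fin 1))} (hC₁ : IsCompact C₁) (hC₂ : IsCompact C₂)
    (hτ : 1 < thickness C₁ * thickness C₂) {V : Type*} [Finite V] {T : SimpleGraph V}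
    (hT : T.IsTree) : (interior (graphDistanceSet T (euclideanProd C₁ C₂))).Nonempty := by
  let e : ℝ ≃ᵢ EuclideanSpace ℝ (Fin 1) :=
    (OrthonormalBasis.singleton (Fin 1) ℝ).repr.toIsometryEquiv
  obtain ⟨τ₁, τ₂, hτ₁, hτ₂, h₁, h₂, hτ₁₂⟩ := exists_pos_ofReal_lt_of_one_lt_mul hτ
  obtain ⟨p, hp⟩ := exists_isThickLeftEnd_preimage e hC₁
    (nontrivial_of_thickness_ne_zero h₁.ne_bot) hτ₁.le h₁.le
  obtain ⟨q, hq⟩ := exists_isThickLeftEnd_preimage e hC₂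
    (nontrivial_of_thickness_ne_zero h₂.ne_bot) hτ₂.le h₂.le
  have hisom : Isometry fun z : ℂ => WithLp.toLp 2 (e z.re, e z.im) := by
    refine Isometry.of_dist_eq fun z w => ?_
    rw [WithLp.prod_dist_eq_of_L2, Complex.dist_eq_re_im]
    simp [e.isometry.dist_eq, Real.dist_eq]
  exact (interior_graphDistanceSet_reProdIm_nonempty hτ₁ hτ₁₂ hp hq hT).mono
    (interior_mono (graphDistanceSet_subset_of_isometry hisom (fun z hz => hz) T))

end ProductsOnThePlane

theorem mainTheorem4 {d : ℕ} (hd : 1 ≤ d) (C₁ C₂ : Set (EuclideanSpace ℝ (Fin d)))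
    (hC₁ : IsCompact C₁) (hC₂ : IsCompact C₂) (hτ : 1 < thickness C₁ * thickness C₂)
    {V : Type*} [Finite V] (T : SimpleGraph V) (hT : T.IsTree) :
    (interior (graphDistanceSet T (euclideanProd C₁ C₂))).Nonempty := by
  rcases hd.eq_or_lt with rfl | hd
  · exact interior_graphDistanceSet_euclideanProd_nonempty_of_one hC₁ hC₂ hτ hT
  have : Nonempty (Fin d) := ⟨⟨0, by lia⟩⟩
  have h₁ : thickness C₁ ≠ 0 := left_ne_zero_of_mul (one_pos.trans hτ).ne'
  have h₂ : thickness C₂ ≠ 0 := right_ne_zero_of_mul (one_pos.trans hτ).ne'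
  exact interior_graphDistanceSet_euclideanProd_nonempty_of_two_le hd hC₁.isClosed h₁
    (nontrivial_of_thickness_ne_zero h₂).nonempty hT
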